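/- A graph is undirected, without loops or multiple edges. Let $R$ be the countable universal graph, that is, the Fraïssé limit of the class of finite graphs: the countable graph into which every finite graph embeds as an induced subgraph and in which every isomorphism between finite induced subgraphs extends to an automorphism. Let $M = \operatorname{End} R$ be its endomorphism monoid, with maps written on the right. For $f, g \in M$ write $f \mathrel{\mathscr{L}} g$ if $Mf = Mg$, $f \mathrel{\mathscr{R}} g$ if $fM = gM$, and let $\mathscr{H} = \mathscr{L} \cap \mathscr{R}$ and $\mathscr{D} = \mathscr{L} \circ \mathscr{R}$. An element $f \in M$ is regular if $fgf = f$ for some $g \in M$, and a $\mathscr{D}$-class is non-regular if it contains no regular element. For an $\mathscr{H}$-class $H$ of $M$ put $T_H = \{t \in M : Ht \subseteq H\}$; the Schützenberger group of $H$ is $\mathcal{S}_H = \{\gamma_t : t \in T_H\}$ under composition, where $\gamma_t \colon H \to H$ is the map $h \mapsto ht$. **Theorem.** Let $\Gamma$ be any countable graph. Then there are exactly $2^{\aleph_0}$ non-regular $\mathscr{D}$-classes $D$ of $\operatorname{End} R$ such that, for every $\mathscr{H}$-class $H$ contained in $D$, the Schützenberger group $\mathcal{S}_H$ is isomorphic to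 $\operatorname{Aut} \Gamma$. -/

import Mathlib

/-- A countable universal homogeneous graph, that is, a Fraïssé limit of the class of finite graphs
(undirected, without loops or multiple edges). -/
structure IsCountableUniversalGraph {V : Type*} (R : SimpleGraph V) : Prop where
  countable : Countable V
  /-- every finite graph is isomorphic to an induced subgraph -/
  universal : ∀ (n : ℕ) (G : SimpleGraph (Fin n)), Nonempty (G ↪g R)
  /-- every isomorphism between finite induced subgraphs extends to an automorphism -/
  homogeneous : ∀ (A : Set V), A.Finite → ∀ f : R.induce A ↪g R,
    ∃ g : R ≃g R, ∀ a : A, g a = f a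

/-- The endomorphism monoid of a graph. Maps are written on the right, so that in the product
`f * g` the map `f` is applied first. -/
abbrev GraphEnd {V : Type*} (R : SimpleGraph V) : Type _ := (R →g R)ᵐᵒᵖ

namespace Green

section
variable {M : Type*} [Monoid M]

/-- Green's relation `L`: equality of the left ideals `M * f` and `M * g`. -/
def RelL (f g : M) : Prop := Set.range (fun m : M => m * f) = Set.range (fun m : M => m * g)

/-- Green's relation `R`: equality of the right ideals `f * M` and `g * M`. -/
def RelR (f g : M) : Prop := Set.range (fun m : M => f * m) = Set.range (fun m : M => g * m)

/-- Green's relation `H`, the intersection of `L` and `R`. -/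
def RelH (f g : M) : Prop := RelL f g ∧ RelR f g

/-- Green's relation `D`, the composite of `L` and `R`. -/
def RelD (f g : M) : Prop := ∃ h : M, RelL f h ∧ RelR h g

/-- The `H`-class of `f`. -/
def classH (f : M) : Set M := {g | RelH f g}

/-- The `D`-class of `f`. -/
def classD (f : M) : Set M := {g | RelD f g}

/-- (von Neumann) regularity of an element of a monoid. -/
def IsRegularElem (f : M) : Prop := ∃ g : M, f * g * f = f

/-- A non-regular `D`-class: a `D`-class that contains no regular element. -/
def IsNonregularClassD (D : Set M) : Prop :=
  (∃ f : M, D = classD f) ∧ ∀ f ∈ D, ¬ IsRegularElem f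

/-- `T_H`, the set of all `t` with `H * t ⊆ H`, as a submonoid. -/
def stabT (H : Set M) : Submonoid M where
  carrier := {t | ∀ h ∈ H, h * t ∈ H}
  one_mem' := fun h hh => by rwa [mul_one]
  mul_mem' := fun {s t} hs ht h hh => by
    rw [← mul_assoc]
    exact ht _ (hs h hh)

/-- The map `t ↦ γ_t`, where `γ_t : H → H` sends `h` to `h * t`. The maps `γ_t` are again composed
from left to right, so `γ_s γ_t = γ_{st}`. -/
def gammaHom (H : Set M) : stabT H →* (Function.End H)ᵐᵒᵖ where
  toFun t := MulOpposite.op (fun h : H => (⟨h.1 * t.1, t.2 h.1 h.2⟩ : H))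
  map_one' := by
    apply MulOpposite.unop_injective
    funext h
    exact Subtype.ext (mul_one h.1)
  map_mul' s t := by
    apply MulOpposite.unop_injective
    funext h
    exact Subtype.ext (mul_assoc h.1 s.1 t.1).symm

/-- The Schützenberger group of an `H`-class `H`: the set of all maps `γ_t : H → H` with `t ∈ T_H`,
under composition. -/
abbrev schutzenbergerGroup (H : Set M) : Submonoid (Function.End H)ᵐᵒᵖ :=
  MonoidHom.mrange (gammaHom H)

end

end Green

/-!
Given graphs `Q ≤ X` on one vertex set, with `Q` isomorphic to the universal graph `R`, every finite
set of vertices has a common neighbour in `X`, because it has one in `Q`. Hence `X` is a retract of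
`R` (`SimpleGraph.HasExtensionProperty.exists_retract`), and `R ≅ Q ≤ X ↪ R` is an injective
endomorphism of `R`, here called `GraphEnd.ofSpanning`. It has the following properties.

* It is non-regular if `X ≠ Q`, since an injective regular endomorphism reflects adjacency
  (`GraphEnd.le_of_isRegularElem`).
* Its `D`-class determines the pair `Q ≤ X` up to isomorphism (`GraphEnd.exists_iso_of_relD`).
* The Schützenberger group of its `H`-class is the group of common automorphisms of `Q` and `X`
  (`GraphEnd.nonempty_schutzenbergerGroup_ofSpanning_equiv`). The retraction is used here to extend
  automorphisms of `X` to endomorphisms of `R`. The Schützenberger groups of all other `H`-classes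
  in the `D`-class are isomorphic to this one (`Green.schutzenbergerGroup_congr_of_relD`).

So it suffices to find, for every set `S` of natural numbers, a pair `Q ≤ X` whose group of common
automorphisms is `Aut Γ`, in such a way that different sets give non-isomorphic pairs. The graph `Q`
is `Vtx.codeGraph`, a variant of the graph of hereditarily finite sets over the vertices of `Γ`, on
which all permutations of the vertices of `Γ` act. The additional edges form `Vtx.markGraph`. They
contain a rigid ray with pendant vertices, whose vertices label the rest of the graph; the labels
encode `S`, and together with a copy of `Γ` they leave no automorphisms but those of `Γ` (`Vtx.markGraph_rigid`).

There are no more than `2 ^ ℵ₀` classes because `R` is countable (`GraphEnd.mk_le`).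
-/

/-! ### Green's relations and Schützenberger groups -/

namespace Green

section
variable {M : Type*} [Monoid M]

lemma relL_iff {f g : M} : RelL f g ↔ (∃ a, f = a * g) ∧ ∃ b, g = b * f := by
  constructor
  · intro h
    constructor
    · have : f ∈ Set.range (fun m : M => m * g) := h ▸ ⟨1, one_mul f⟩
      obtain ⟨a, ha⟩ := this
      exact ⟨a, ha.symm⟩
    · have : g ∈ Set.range (fun m : M => m * f) := h ▸ ⟨1, one_mul g⟩
      obtain ⟨a, ha⟩ := this
      exact ⟨a, ha.symm⟩
  · rintro ⟨⟨a, ha⟩, b, hb⟩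
    apply Set.Subset.antisymm
    · rintro _ ⟨m, rfl⟩
      exact ⟨m * a, by simp only [mul_assoc, ← ha]⟩
    · rintro _ ⟨m, rfl⟩
      exact ⟨m * b, by simp only [mul_assoc, ← hb]⟩

lemma relR_iff {f g : M} : RelR f g ↔ (∃ a, f = g * a) ∧ ∃ b, g = f * b := by
  constructor
  · intro h
    constructor
    · have : f ∈ Set.range (fun m : M => g * m) := h ▸ ⟨1, mul_one f⟩
      obtain ⟨a, ha⟩ := this
      exact ⟨a, ha.symm⟩
    · have : g ∈ Set.range (fun m : M => f * m) := h ▸ ⟨1, mul_one g⟩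
      obtain ⟨a, ha⟩ := this
      exact ⟨a, ha.symm⟩
  · rintro ⟨⟨a, ha⟩, b, hb⟩
    apply Set.Subset.antisymm
    · rintro _ ⟨m, rfl⟩
      exact ⟨a * m, by simp only [← mul_assoc, ← ha]⟩
    · rintro _ ⟨m, rfl⟩
      exact ⟨b * m, by simp only [← mul_assoc, ← hb]⟩

lemma RelL.mul_right {f g : M} (h : RelL f g) (t : M) : RelL (f * t) (g * t) := by
  obtain ⟨⟨a, ha⟩, b, hb⟩ := relL_iff.1 h
  exact relL_iff.2 ⟨⟨a, by rw [← mul_assoc, ← ha]⟩, b, by rw [← mul_assoc, ← hb]⟩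

lemma RelR.mul_left {f g : M} (h : RelR f g) (t : M) : RelR (t * f) (t * g) := by
  obtain ⟨⟨a, ha⟩, b, hb⟩ := relR_iff.1 h
  exact relR_iff.2 ⟨⟨a, by rw [mul_assoc, ← ha]⟩, b, by rw [mul_assoc, ← hb]⟩

lemma relD_refl (f : M) : RelD f f := ⟨f, rfl, rfl⟩

/-- Whether right multiplication by `t` keeps an element in its `R`-class depends on its `L`-class
only. -/
lemma relR_mul_of_relL {f g t : M} (h : RelL f g) (ht : RelR (f * t) f) : RelR (g * t) g := by
  obtain ⟨-, b, rfl⟩ := relL_iff.1 h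
  simpa only [mul_assoc] using ht.mul_left b

lemma relH_mul_of_relH {f g t : M} (h : RelH f g) (ht : RelH f (f * t)) : RelH f (g * t) := by
  refine ⟨ht.1.trans (h.1.mul_right t), ?_⟩
  exact h.2.trans (relR_mul_of_relL h.1 ht.2.symm).symm

lemma mem_stabT_classH {f t : M} : t ∈ stabT (classH f) ↔ RelH f (f * t) :=
  ⟨fun h => h f ⟨rfl, rfl⟩, fun h _ hg => relH_mul_of_relH hg h⟩

/-- Two maps `γ_s` and `γ_t` on an `H`-class agree as soon as they agree at one point. -/
lemma gammaHom_eq_iff {f : M} {s t : stabT (classH f)} :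
    gammaHom (classH f) s = gammaHom (classH f) t ↔ f * s = f * t := by
  constructor
  · intro h
    have := congrArg (fun γ => ((MulOpposite.unop γ) ⟨f, rfl, rfl⟩ : classH f).1) h
    exact this
  · intro h
    apply MulOpposite.unop_injective
    funext ⟨g, hg⟩
    apply Subtype.ext
    obtain ⟨-, b, rfl⟩ := relL_iff.1 hg.1
    change b * f * s = b * f * t
    rw [mul_assoc, h, mul_assoc]

/-- A bijection between two sets that carries the maps `γ_t` of one to the maps `γ_t` of the other
induces an isomorphism of the groups they form. -/
lemma nonempty_mulEquiv_of_conj {H K : Set M} (e : H ≃ K)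
    (h₁ : ∀ t (ht : t ∈ stabT H), ∃ s ∈ stabT K, ∀ h : H, (e h : M) * s = e ⟨h * t, ht h h.2⟩)
    (h₂ : ∀ s (hs : s ∈ stabT K), ∃ t ∈ stabT H,
      ∀ k : K, (e.symm k : M) * t = e.symm ⟨k * s, hs k k.2⟩) :
    Nonempty (schutzenbergerGroup H ≃* schutzenbergerGroup K) := by
  let c : (Function.End H)ᵐᵒᵖ ≃* (Function.End K)ᵐᵒᵖ :=
    { toFun γ := MulOpposite.op (fun k : K => e (γ.unop (e.symm k)))
      invFun γ := MulOpposite.op (fun h : H => e.symm (γ.unop (e h)))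
      left_inv γ := by
        apply MulOpposite.unop_injective
        funext h
        change e.symm (e (γ.unop (e.symm (e h)))) = γ.unop h
        rw [e.symm_apply_apply, e.symm_apply_apply]
      right_inv γ := by
        apply MulOpposite.unop_injective
        funext k
        change e (e.symm (γ.unop (e (e.symm k)))) = γ.unop k
        rw [e.apply_symm_apply, e.apply_symm_apply]
      map_mul' γ δ := by
        apply MulOpposite.unop_injective
        funext k
        change e (δ.unop (γ.unop (e.symm k))) = e (δ.unop (e.symm (e (γ.unop (e.symm k)))))
        rw [e.symm_apply_apply] }
  have key : (schutzenbergerGroup H).map c.toMonoidHom = schutzenbergerGroup K := by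
    apply le_antisymm
    · rintro _ ⟨_, ⟨t, rfl⟩, rfl⟩
      obtain ⟨s, hs, hst⟩ := h₁ t.1 t.2
      refine ⟨⟨s, hs⟩, ?_⟩
      apply MulOpposite.unop_injective
      funext k
      apply Subtype.ext
      have := hst (e.symm k)
      rw [e.apply_symm_apply] at this
      exact this
    · rintro _ ⟨s, rfl⟩
      obtain ⟨t, ht, hst⟩ := h₂ s.1 s.2
      refine ⟨_, ⟨⟨t, ht⟩, rfl⟩, ?_⟩
      apply MulOpposite.unop_injective
      funext k
      change e ⟨(e.symm k : M) * t, _⟩ = ⟨k * s, _⟩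
      rw [← e.eq_symm_apply]
      exact Subtype.ext (hst k)
  exact ⟨(c.submonoidMap _).trans (MulEquiv.submonoidCongr key)⟩

lemma schutzenbergerGroup_congr_of_relL {f g : M} (h : RelL f g) :
    Nonempty (schutzenbergerGroup (classH f) ≃* schutzenbergerGroup (classH g)) := by
  obtain ⟨⟨a, ha⟩, b, hb⟩ := relL_iff.1 h
  have stab {f g t : M} (h : RelL f g) (ht : t ∈ stabT (classH f)) : t ∈ stabT (classH g) := by
    rw [mem_stabT_classH] at ht ⊢
    exact ⟨h.symm.trans (ht.1.trans (h.mul_right t)), (relR_mul_of_relL h ht.2.symm).symm⟩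
  have mem {f g b x : M} (h : RelL f g) (hb : g = b * f) (hx : x ∈ classH f) :
      b * x ∈ classH g := by
    obtain ⟨⟨c, hc⟩, d, rfl⟩ := relR_iff.1 hx.2
    refine ⟨?_, ?_⟩
    · rw [← mul_assoc, ← hb]
      exact h.symm.trans (hx.1.trans (h.mul_right d))
    · rw [hb]
      exact hx.2.mul_left b
  have inv {f g a b x : M} (ha : f = a * g) (hb : g = b * f) (hx : x ∈ classH f) :
      a * (b * x) = x := by
    obtain ⟨-, d, rfl⟩ := relR_iff.1 hx.2
    rw [← mul_assoc b, ← hb, ← mul_assoc, ← ha]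
  let e : classH f ≃ classH g :=
    { toFun x := ⟨b * x, mem h hb x.2⟩
      invFun x := ⟨a * x, mem h.symm ha x.2⟩
      left_inv x := Subtype.ext (inv ha hb x.2)
      right_inv x := Subtype.ext (inv hb ha x.2) }
  exact nonempty_mulEquiv_of_conj e (fun t ht => ⟨t, stab h ht, fun x => mul_assoc _ _ _⟩)
    (fun t ht => ⟨t, stab h.symm ht, fun x => mul_assoc _ _ _⟩)

lemma schutzenbergerGroup_congr_of_relR {f g : M} (h : RelR f g) :
    Nonempty (schutzenbergerGroup (classH f) ≃* schutzenbergerGroup (classH g)) := by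
  obtain ⟨⟨y, hy⟩, x, hx⟩ := relR_iff.1 h
  -- Right translation by `x` is inverse to right translation by `y` on the `L`-class of `f`.
  have inv {f g x y z : M} (hy : f = g * y) (hx : g = f * x) (hz : RelL f z) :
      z * x * y = z := by
    obtain ⟨-, m, rfl⟩ := relL_iff.1 hz
    rw [mul_assoc m, ← hx, mul_assoc, ← hy]
  have mem {f g x y z : M} (hy : f = g * y) (hx : g = f * x) (hz : z ∈ classH f) :
      z * x ∈ classH g := by
    refine ⟨hx ▸ hz.1.mul_right x, ?_⟩
    have h₁ : RelR f g := relR_iff.2 ⟨⟨y, hy⟩, x, hx⟩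
    have h₂ : RelR (z * x) z := relR_iff.2 ⟨⟨x, rfl⟩, y, (inv hy hx hz.1).symm⟩
    exact h₁.symm.trans (hz.2.trans h₂.symm)
  let e : classH f ≃ classH g :=
    { toFun z := ⟨z * x, mem hy hx z.2⟩
      invFun z := ⟨z * y, mem hx hy z.2⟩
      left_inv z := Subtype.ext (inv hy hx z.2.1)
      right_inv z := Subtype.ext (inv hx hy z.2.1) }
  have stab {f g x y t : M} (hy : f = g * y) (hx : g = f * x) (ht : t ∈ stabT (classH f)) :
      y * t * x ∈ stabT (classH g) := by
    rw [mem_stabT_classH] at ht ⊢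
    rw [← mul_assoc, ← mul_assoc, ← hy]
    exact mem hy hx ht
  refine nonempty_mulEquiv_of_conj e (fun t ht => ⟨y * t * x, stab hy hx ht, fun z => ?_⟩)
    (fun t ht => ⟨x * t * y, stab hx hy ht, fun z => ?_⟩)
  · change z * x * (y * t * x) = z * t * x
    rw [← mul_assoc, ← mul_assoc, inv hy hx z.2.1]
  · change z * y * (x * t * y) = z * t * y
    rw [← mul_assoc, ← mul_assoc, inv hx hy z.2.1]

/-- The Schützenberger groups of all `H`-classes in one `D`-class are isomorphic. -/
lemma schutzenbergerGroup_congr_of_relD {f g : M} (h : RelD f g) :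
    Nonempty (schutzenbergerGroup (classH f) ≃* schutzenbergerGroup (classH g)) := by
  obtain ⟨k, h₁, h₂⟩ := h
  obtain ⟨e₁⟩ := schutzenbergerGroup_congr_of_relL h₁
  obtain ⟨e₂⟩ := schutzenbergerGroup_congr_of_relR h₂
  exact ⟨e₁.trans e₂⟩

lemma IsRegularElem.of_relL {f g : M} (h : RelL f g) (hg : IsRegularElem g) :
    IsRegularElem f := by
  obtain ⟨⟨a, rfl⟩, b, hb⟩ := relL_iff.1 h
  obtain ⟨x, hx⟩ := hg
  refine ⟨x * b, ?_⟩
  calc a * g * (x * b) * (a * g) = a * (g * x * (b * (a * g))) := by simp only [mul_assoc]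
    _ = a * g := by rw [← hb, hx]

lemma IsRegularElem.of_relR {f g : M} (h : RelR f g) (hg : IsRegularElem g) :
    IsRegularElem f := by
  obtain ⟨⟨a, rfl⟩, b, hb⟩ := relR_iff.1 h
  obtain ⟨x, hx⟩ := hg
  refine ⟨b * x, ?_⟩
  calc g * a * (b * x) * (g * a) = (g * a * b) * x * g * a := by simp only [mul_assoc]
    _ = g * a := by rw [← hb, hx]

lemma IsRegularElem.of_relD {f g : M} (h : RelD f g) (hg : IsRegularElem g) :
    IsRegularElem f := by
  obtain ⟨k, h₁, h₂⟩ := h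
  exact (hg.of_relR h₂).of_relL h₁

end

end Green

/-! ### The extension property of the countable universal graph -/

/-- The extension property: for disjoint finite sets `A` and `B` of vertices there is a vertex
outside `B` that is adjacent to all vertices in `A` and to none in `B`. (It lies outside `A` because
graphs have no loops.) -/
def SimpleGraph.HasExtensionProperty {α : Type*} (G : SimpleGraph α) : Prop :=
  ∀ A B : Finset α, Disjoint A B →
    ∃ z, z ∉ B ∧ (∀ a ∈ A, G.Adj z a) ∧ ∀ b ∈ B, ¬ G.Adj z b

theorem IsCountableUniversalGraph.hasExtensionProperty {V : Type*} {R : SimpleGraph V}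
    (hR : IsCountableUniversalGraph R) : R.HasExtensionProperty := by
  classical
  intro A B hAB
  let C : Set V := ↑(A ∪ B)
  have hC : C.Finite := (A ∪ B).finite_toSet
  have : Fintype C := hC.fintype
  -- The graph induced on `A ∪ B` together with one new vertex adjacent to `A` only.
  let G : SimpleGraph (Option C) :=
    SimpleGraph.fromRel fun x y => match x, y with
      | some x, some y => R.Adj x y
      | none, some y => y.1 ∈ A
      | _, _ => False
  let e := Fintype.equivFin (Option C)
  obtain ⟨i⟩ := hR.universal _ (G.map e.toEmbedding)
  let i' : G ↪g R := (SimpleGraph.Embedding.map e.toEmbedding G).trans i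
  let j : R.induce C ↪g G :=
    { toFun := some
      inj' := Option.some_injective _
      map_rel_iff' := by
        intro x y
        simp only [G, SimpleGraph.fromRel_adj, Function.Embedding.coeFn_mk,
          SimpleGraph.comap_adj, Function.Embedding.subtype_apply, ne_eq, Option.some.injEq]
        constructor
        · rintro ⟨-, h | h⟩
          · exact h
          · exact h.symm
        · exact fun h => ⟨fun hxy => h.ne (congrArg _ hxy), Or.inl h⟩ }
  obtain ⟨g, hg⟩ := hR.homogeneous C hC (j.trans i')
  have key (x : C) : R.Adj (g.symm (i' none)) x ↔ x.1 ∈ A := by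
    rw [← g.map_adj_iff, g.apply_symm_apply, hg x]
    change R.Adj (i' none) (i' (some x)) ↔ _
    rw [i'.map_adj_iff]
    simp [G, SimpleGraph.fromRel_adj]
  refine ⟨g.symm (i' none), fun h => ?_, fun a ha => ?_, fun b hb => ?_⟩
  · have h' : g.symm (i' none) ∈ C := by simp [C, h]
    have := hg ⟨_, h'⟩
    rw [g.apply_symm_apply] at this
    exact Option.some_ne_none _ (i'.injective this).symm
  · exact (key ⟨a, by simp [C, ha]⟩).2 ha
  · exact fun h => Finset.disjoint_left.1 hAB ((key ⟨b, by simp [C, hb]⟩).1 h) hb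

section BackAndForth

variable {α β : Type*}

/-- Finite sets of pairs that are isomorphisms between finite induced subgraphs of `G` and `H`. -/
def SimpleGraph.IsPartialIso (G : SimpleGraph α) (H : SimpleGraph β) (s : Finset (α × β)) : Prop :=
  ∀ p ∈ s, ∀ q ∈ s, (p.1 = q.1 ↔ p.2 = q.2) ∧ (G.Adj p.1 q.1 ↔ H.Adj p.2 q.2)

namespace SimpleGraph

variable {G : SimpleGraph α} {H : SimpleGraph β}

lemma HasExtensionProperty.exists_extend [DecidableEq α] [DecidableEq β]
    (hH : H.HasExtensionProperty) {s : Finset (α × β)}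
    (hs : G.IsPartialIso H s) (x : α) : ∃ y, G.IsPartialIso H (insert (x, y) s) := by
  classical
  by_cases hx : ∃ y, (x, y) ∈ s
  · obtain ⟨y, hy⟩ := hx
    exact ⟨y, by rwa [Finset.insert_eq_of_mem hy]⟩
  obtain ⟨y, hyB, hA, hB⟩ := hH ((s.filter fun p => G.Adj x p.1).image Prod.snd)
    ((s.filter fun p => ¬ G.Adj x p.1).image Prod.snd) (by
      rw [Finset.disjoint_left]
      intro y h₁ h₂
      simp only [Finset.mem_image, Finset.mem_filter] at h₁ h₂
      obtain ⟨p, ⟨hp, hp'⟩, rfl⟩ := h₁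
      obtain ⟨q, ⟨hq, hq'⟩, hqp⟩ := h₂
      exact hq' (((hs q hq p hp).1.2 hqp) ▸ hp'))
  have adj (p) (hp : p ∈ s) : G.Adj x p.1 ↔ H.Adj y p.2 := by
    by_cases h : G.Adj x p.1
    · exact iff_of_true h (hA _ (Finset.mem_image_of_mem _ (Finset.mem_filter.2 ⟨hp, h⟩)))
    · exact iff_of_false h (hB _ (Finset.mem_image_of_mem _ (Finset.mem_filter.2 ⟨hp, h⟩)))
  have ne (p) (hp : p ∈ s) : x ≠ p.1 ∧ y ≠ p.2 := by
    refine ⟨fun h => hx ⟨p.2, h ▸ hp⟩, fun h => ?_⟩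
    by_cases h' : G.Adj x p.1
    · exact ((adj p hp).1 h').ne h
    · exact hyB (h ▸ Finset.mem_image_of_mem _ (Finset.mem_filter.2 ⟨hp, h'⟩))
  refine ⟨y, fun p hp q hq => ?_⟩
  rw [Finset.mem_insert] at hp hq
  rcases hp with rfl | hp <;> rcases hq with rfl | hq
  · simp
  · exact ⟨iff_of_false (ne q hq).1 (ne q hq).2, adj q hq⟩
  · exact ⟨iff_of_false (ne p hp).1.symm (ne p hp).2.symm,
      by rw [G.adj_comm, H.adj_comm]; exact adj p hp⟩
  · exact hs p hp q hq

lemma IsPartialIso.swap [DecidableEq α] [DecidableEq β] {s : Finset (α × β)}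
    (hs : G.IsPartialIso H s) : H.IsPartialIso G (s.image Prod.swap) := by
  intro p hp q hq
  rw [Finset.mem_image] at hp hq
  obtain ⟨p, hp, rfl⟩ := hp
  obtain ⟨q, hq, rfl⟩ := hq
  exact ⟨(hs p hp q hq).1.symm, (hs p hp q hq).2.symm⟩

/-- Back and forth: two countable graphs with the extension property are isomorphic. -/
theorem HasExtensionProperty.nonempty_iso [Countable α] [Countable β]
    (hG : G.HasExtensionProperty) (hH : H.HasExtensionProperty) : Nonempty (G ≃g H) := by
  classical
  have := Encodable.ofCountable α
  have := Encodable.ofCountable β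
  let P := {s : Finset (α × β) // G.IsPartialIso H s}
  let D : α ⊕ β → Order.Cofinal P := Sum.elim
    (fun x =>
      { carrier := {s | ∃ y, (x, y) ∈ s.1}
        isCofinal := fun s => by
          obtain ⟨y, hy⟩ := hH.exists_extend s.2 x
          exact ⟨⟨_, hy⟩, ⟨y, Finset.mem_insert_self _ _⟩, Finset.subset_insert _ _⟩ })
    (fun y =>
      { carrier := {s | ∃ x, (x, y) ∈ s.1}
        isCofinal := fun s => by
          obtain ⟨x, hx⟩ := hG.exists_extend s.2.swap y
          refine ⟨⟨_, hx.swap⟩, ⟨x, ?_⟩, fun p hp => ?_⟩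
          · exact Finset.mem_image_of_mem Prod.swap (Finset.mem_insert_self _ _)
          · exact Finset.mem_image.2 ⟨p.swap, Finset.mem_insert_of_mem
              (Finset.mem_image_of_mem _ hp), Prod.swap_swap p⟩ })
  let p₀ : P := ⟨∅, fun _ h => absurd h (Finset.notMem_empty _)⟩
  let I := Order.idealOfCofinals p₀ D
  have hI {p q : α × β} (hp : ∃ s ∈ I, p ∈ s.1) (hq : ∃ s ∈ I, q ∈ s.1) :
      (p.1 = q.1 ↔ p.2 = q.2) ∧ (G.Adj p.1 q.1 ↔ H.Adj p.2 q.2) := by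
    obtain ⟨s, hs, hp⟩ := hp
    obtain ⟨t, ht, hq⟩ := hq
    obtain ⟨u, -, hsu, htu⟩ := I.directed s hs t ht
    exact u.2 p (hsu hp) q (htu hq)
  have h₁ (x : α) : ∃ y, ∃ s ∈ I, (x, y) ∈ s.1 := by
    obtain ⟨s, ⟨y, hy⟩, hs⟩ := Order.cofinal_meets_idealOfCofinals p₀ D (Sum.inl x)
    exact ⟨y, s, hs, hy⟩
  have h₂ (y : β) : ∃ x, ∃ s ∈ I, (x, y) ∈ s.1 := by
    obtain ⟨s, ⟨x, hx⟩, hs⟩ := Order.cofinal_meets_idealOfCofinals p₀ D (Sum.inr y)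
    exact ⟨x, s, hs, hx⟩
  choose F hF using h₁
  choose K hK using h₂
  exact ⟨{ toFun := F
           invFun := K
           left_inv := fun x => (hI (hK (F x)) (hF x)).1.2 rfl
           right_inv := fun y => (hI (hF (K y)) (hK y)).1.1 rfl
           map_rel_iff' := fun {x y} => (hI (hF x) (hF y)).2.symm }⟩

end SimpleGraph

end BackAndForth

/-! ### Embedding a graph as a retract of the countable universal graph -/

/-- There are arbitrarily large numbers whose binary expansion has a digit `1` at all places in a
given finite set `A`, and otherwise only at a place that codes a large number. -/
lemma exists_bitIndices (A : Finset ℕ) (m : ℕ) :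
    ∃ k, m < k ∧ (∀ a ∈ A, a ∈ k.bitIndices) ∧ ∀ c ∈ k.bitIndices, c ∈ A ∨ c = Nat.pair 0 m := by
  obtain ⟨k, hk⟩ := Finset.equivBitIndices.surjective (insert (Nat.pair 0 m) A)
  have h (c : ℕ) : c ∈ k.bitIndices ↔ c = Nat.pair 0 m ∨ c ∈ A := by
    rw [← Finset.mem_insert, ← hk]
    simp [Finset.equivBitIndices]
  refine ⟨k, ?_, fun a ha => (h a).2 (Or.inr ha), fun c hc => ((h c).1 hc).symm⟩
  calc m ≤ Nat.pair 0 m := Nat.right_le_pair _ _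
    _ < 2 ^ Nat.pair 0 m := Nat.lt_two_pow_self
    _ ≤ k := Nat.two_pow_le_of_mem_bitIndices ((h _).2 (Or.inl rfl))

lemma lt_of_pair_mem_bitIndices {a b k : ℕ} (h : Nat.pair a b ∈ k.bitIndices) : b < k :=
  calc b ≤ Nat.pair a b := Nat.right_le_pair _ _
    _ < 2 ^ Nat.pair a b := Nat.lt_two_pow_self
    _ ≤ k := Nat.two_pow_le_of_mem_bitIndices h

namespace SimpleGraph

variable {α : Type*}

/-- A graph on `α × ℕ` that retracts onto the copy `α × {0}` of `X`. Vertices in different layers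
whose projections are adjacent are joined according to the binary digits of the number of the
higher layer, so that the extension property holds if `X` is algebraically closed. -/
def extGraph [Encodable α] (X : SimpleGraph α) : SimpleGraph (α × ℕ) where
  Adj p q := X.Adj p.1 q.1 ∧ ((p.2 = 0 ∧ q.2 = 0) ∨
    Nat.pair (Encodable.encode p.1) p.2 ∈ q.2.bitIndices ∨
    Nat.pair (Encodable.encode q.1) q.2 ∈ p.2.bitIndices)
  symm := ⟨fun p q h => ⟨h.1.symm, by tauto⟩⟩
  loopless := ⟨fun p h => X.loopless.irrefl _ h.1⟩

lemma extGraph_hasExtensionProperty [Encodable α] {X : SimpleGraph α}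
    (hX : ∀ A : Finset α, ∃ z, ∀ a ∈ A, X.Adj z a) : X.extGraph.HasExtensionProperty := by
  classical
  intro A B hAB
  obtain ⟨z, hz⟩ := hX (A.image Prod.fst)
  let m := (A ∪ B).sup Prod.snd
  have hm (p) (hp : p ∈ A ∪ B) : p.2 ≤ m := Finset.le_sup (f := Prod.snd) hp
  obtain ⟨k, hmk, hk, hk'⟩ := exists_bitIndices
    (A.image fun p => Nat.pair (Encodable.encode p.1) p.2) (m + 1)
  refine ⟨(z, k), fun h => ?_, fun a ha => ?_, fun b hb => ?_⟩
  · have := hm _ (Finset.mem_union_right _ h)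
    grind
  · exact ⟨hz _ (Finset.mem_image_of_mem _ ha),
      Or.inr (Or.inr (hk _ (Finset.mem_image_of_mem _ ha)))⟩
  · have hbm := hm _ (Finset.mem_union_right _ hb)
    rintro ⟨-, ⟨h, -⟩ | h | h⟩
    · simp only at h
      omega
    · have := lt_of_pair_mem_bitIndices h
      omega
    · rcases hk' _ h with h | h
      · rw [Finset.mem_image] at h
        obtain ⟨a, ha, hab⟩ := h
        rw [Nat.pair_eq_pair, Encodable.encode_inj] at hab
        exact Finset.disjoint_left.1 hAB ha (Prod.ext hab.1 hab.2 ▸ hb)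
      · rw [Nat.pair_eq_pair] at h
        omega

/-- Countable algebraically closed graphs are retracts of the countable universal graph. -/
theorem HasExtensionProperty.exists_retract {V : Type*} [Countable V] {R : SimpleGraph V}
    (hR : R.HasExtensionProperty) [Countable α] {X : SimpleGraph α}
    (hX : ∀ A : Finset α, ∃ z, ∀ a ∈ A, X.Adj z a) :
    ∃ (i : X ↪g R) (r : R →g X), ∀ x, r (i x) = x := by
  have := Encodable.ofCountable α
  obtain ⟨e⟩ := (extGraph_hasExtensionProperty hX).nonempty_iso hR
  let i : X ↪g X.extGraph :=
    { toFun := fun x => (x, 0)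
      inj' := fun x y h => (Prod.ext_iff.1 h).1
      map_rel_iff' := ⟨fun h => h.1, fun h => ⟨h, Or.inl ⟨rfl, rfl⟩⟩⟩ }
  let r : X.extGraph →g X :=
    { toFun := Prod.fst
      map_rel' := fun h => h.1 }
  refine ⟨i.trans e.toEmbedding, r.comp e.symm.toHom, fun x => ?_⟩
  change (e.symm (e (x, 0))).1 = x
  rw [e.symm_apply_apply]

end SimpleGraph

/-! ### A copy of the universal graph over a set of atoms -/

/-- The vertices of a copy of the countable universal graph on which the permutations of `W` act. -/
inductive Vtx (W : Type*) : Type _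
  /-- the vertices of a ray -/
  | ray (i : ℕ)
  /-- the pendant vertices of the ray -/
  | leaf (i : ℕ)
  /-- the `i`-th copy of the element `w` -/
  | elt (i : ℕ) (w : W)
  /-- the vertices that code finite sets of vertices: the set coded by `name l k` is obtained from
  the number `k` with the help of the parameters `l` -/
  | name (l : List W) (k : ℕ)

namespace Vtx

variable {W : Type*}

/-- The parameters from `W` on which a vertex depends. -/
def params : Vtx W → List W
  | ray _ => []
  | leaf _ => []
  | elt _ w => [w]
  | name l _ => l

/-- A number that, together with the parameters, determines a vertex. -/
def num : Vtx W → ℕ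
  | ray i => 4 * i
  | leaf i => 4 * i + 1
  | elt i _ => 4 * i + 2
  | name _ k => 4 * k + 3

lemma ext_params_num {u v : Vtx W} (h₁ : u.params = v.params) (h₂ : u.num = v.num) : u = v := by
  cases u <;> cases v <;> simp only [params, num, List.cons.injEq, and_true] at h₁ h₂ <;>
    first
    | omega
    | (congr 1; omega)

instance [Countable W] : Countable (Vtx W) :=
  Function.Injective.countable (f := fun v : Vtx W => (v.params, v.num)) fun _ _ h =>
    ext_params_num (Prod.ext_iff.1 h).1 (Prod.ext_iff.1 h).2

/-- The action of a map `W → W'` on vertices. -/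
def map {W' : Type*} (σ : W → W') : Vtx W → Vtx W'
  | ray i => ray i
  | leaf i => leaf i
  | elt i w => elt i (σ w)
  | name l k => name (l.map σ) k

lemma params_map {W' : Type*} (σ : W → W') (v : Vtx W) : (v.map σ).params = v.params.map σ := by
  cases v <;> rfl

lemma num_map {W' : Type*} (σ : W → W') (v : Vtx W) : (v.map σ).num = v.num := by
  cases v <;> rfl

lemma map_map {W' W'' : Type*} (σ : W → W') (τ : W' → W'') (v : Vtx W) :
    (v.map σ).map τ = v.map (τ ∘ σ) := by
  cases v <;> simp [map]

lemma map_id (v : Vtx W) : v.map id = v := by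
  cases v <;> simp [map]

/-- `Codes u v` says that `v` is a vertex `name l k` and that `u` belongs to the finite set it
codes: a binary digit of `k` describes `u` by its number and by the positions at which its
parameters occur in `l`. -/
def Codes (u : Vtx W) : Vtx W → Prop
  | name l k => ∃ p : List ℕ, u.params = p.filterMap (fun i => l[i]?) ∧
      Nat.pair (Encodable.encode p) u.num ∈ k.bitIndices
  | _ => False

lemma Codes.num_lt {u : Vtx W} {l : List W} {k : ℕ} (h : Codes u (name l k)) : u.num < k := by
  obtain ⟨p, -, hp⟩ := h
  exact lt_of_pair_mem_bitIndices hp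

lemma not_codes_self (u : Vtx W) : ¬ Codes u u := by
  cases u with
  | name l k =>
    intro h
    have := h.num_lt
    simp only [num] at this
    omega
  | _ => exact id

lemma Codes.map {W' : Type*} {u v : Vtx W} (h : Codes u v) (σ : W → W') :
    Codes (u.map σ) (v.map σ) := by
  cases v with
  | name l k =>
    obtain ⟨p, hp, hk⟩ := h
    refine ⟨p, ?_, by rwa [num_map]⟩
    rw [params_map, hp, List.map_filterMap]
    congr 1
    funext i
    simp
  | _ => exact h.elim

/-- The graph in which `name l k` is joined to the vertices in the finite set it codes. -/
def codeGraph (W : Type*) : SimpleGraph (Vtx W) where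
  Adj u v := Codes u v ∨ Codes v u
  symm := ⟨fun _ _ h => h.symm⟩
  loopless := ⟨fun u h => not_codes_self u (or_self_iff.1 h)⟩

lemma codeGraph_adj_map {u v : Vtx W} {W' : Type*} (σ : W → W') (h : (codeGraph W).Adj u v) :
    (codeGraph W').Adj (u.map σ) (v.map σ) :=
  h.imp (fun h => h.map σ) (fun h => h.map σ)

lemma exists_filterMap_eq (l l' : List W) (h : ∀ w ∈ l', w ∈ l) :
    ∃ p : List ℕ, l' = p.filterMap fun i => l[i]? := by
  induction l' with
  | nil => exact ⟨[], rfl⟩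
  | cons w l' ih =>
    obtain ⟨p, hp⟩ := ih fun w hw => h w (List.mem_cons_of_mem _ hw)
    obtain ⟨i, hi⟩ := List.mem_iff_getElem?.1 (h w List.mem_cons_self)
    exact ⟨i :: p, by rw [List.filterMap_cons_some hi, ← hp]⟩

theorem codeGraph_hasExtensionProperty (W : Type*) : (codeGraph W).HasExtensionProperty := by
  classical
  intro A B hAB
  let m := (A ∪ B).sup num
  have hm (p) (hp : p ∈ A ∪ B) : p.num ≤ m := Finset.le_sup (f := num) hp
  let l := A.toList.flatMap params
  have hl (a) : ∃ p : List ℕ, a ∈ A → a.params = p.filterMap fun i => l[i]? := by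
    by_cases ha : a ∈ A
    · obtain ⟨p, hp⟩ := exists_filterMap_eq l a.params fun w hw =>
        List.mem_flatMap.2 ⟨a, Finset.mem_toList.2 ha, hw⟩
      exact ⟨p, fun _ => hp⟩
    · exact ⟨[], fun h => absurd h ha⟩
  choose p hp using hl
  obtain ⟨k, hmk, hk, hk'⟩ := exists_bitIndices
    (A.image fun a => Nat.pair (Encodable.encode (p a)) a.num) (m + 1)
  -- As `k` exceeds all numbers in `B`, no vertex in `B` codes a set that contains `name l k`.
  refine ⟨name l k, fun h => ?_, fun a ha => ?_, fun b hb => ?_⟩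
  · have := hm _ (Finset.mem_union_right _ h)
    simp only [num] at this
    omega
  · exact Or.inr ⟨p a, hp a ha, hk _ (Finset.mem_image_of_mem _ ha)⟩
  · have hbm := hm _ (Finset.mem_union_right _ hb)
    rintro (h | ⟨q, hq, h⟩)
    · cases b with
      | name l' k' =>
        have := h.num_lt
        simp only [num] at this hbm
        omega
      | _ => exact h
    · rcases hk' _ h with h | h
      · rw [Finset.mem_image] at h
        obtain ⟨a, ha, hab⟩ := h
        rw [Nat.pair_eq_pair, Encodable.encode_inj] at hab
        have : a = b := ext_params_num (by rw [hp a ha, hab.1, hq]) hab.2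
        exact Finset.disjoint_left.1 hAB ha (this ▸ hb)
      · rw [Nat.pair_eq_pair] at h
        omega

/-! ### Additional edges that leave only the automorphisms of `Γ` -/

variable (Γ : SimpleGraph W) (S : Set ℕ)

/-- One orientation of the additional edges. The vertices of the ray, which can be told apart by
means of the leaves, label the remaining vertices: `elt i w` has the label `{0, i + 1}`, and
`name l k` has the label `{k + 1, k + 2} ∪ {k + 3 + j | j ∈ S}`. The copy of `Γ` lies on the vertices
`elt 0 w`, and `elt i w` is tied to `elt 0 w`. The entries of `l` can be read off from the edges
between `name l k` and the vertices `elt i w` with `k < i`. -/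
def Marks : Vtx W → Vtx W → Prop
  | ray i, ray j => j = i + 1
  | ray i, leaf j => i = j
  | ray i, elt j _ => i = 0 ∨ i = j + 1
  | ray i, name _ k => i = k + 1 ∨ i = k + 2 ∨ ∃ j ∈ S, i = k + 3 + j
  | elt i w, elt j w' => i = 0 ∧ ((j = 0 ∧ Γ.Adj w w') ∨ (j ≠ 0 ∧ w = w'))
  | elt i w, name l k => ∃ j, i = k + 1 + j ∧ l[j]? = some w
  | _, _ => False

lemma not_marks_self (u : Vtx W) : ¬ Marks Γ S u u := by
  cases u <;> simp [Marks]

/-- The graph of additional edges. It is made so that its automorphisms are those of `Γ`, and so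
that it determines the set `S`. -/
def markGraph : SimpleGraph (Vtx W) where
  Adj u v := Marks Γ S u v ∨ Marks Γ S v u
  symm := ⟨fun _ _ h => h.symm⟩
  loopless := ⟨fun u h => not_marks_self Γ S u (or_self_iff.1 h)⟩

variable {Γ S}

/-- The numbers of the coded vertices of `name l k` are less than `k`, whereas the additional edges
at `name l k` lead to vertices with larger numbers. -/
lemma not_codes_of_marks {u v : Vtx W} (h : Marks Γ S u v) : ¬ Codes u v := by
  cases v with
  | name l k =>
    intro h'
    have := h'.num_lt
    cases u with
    | ray i =>
      simp only [num] at this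
      rcases h with h | h | ⟨j, -, h⟩ <;> omega
    | elt i w =>
      simp only [num] at this
      obtain ⟨j, h, -⟩ := h
      omega
    | _ => exact h
  | _ => exact id

/-- Every additional edge at a vertex `name l k` is oriented towards that vertex. -/
lemma not_codes_of_marks' {u v : Vtx W} (h : Marks Γ S u v) : ¬ Codes v u := by
  cases u with
  | name l k => cases v <;> exact h.elim
  | _ => exact id

lemma disjoint_codeGraph_markGraph : Disjoint (codeGraph W) (markGraph Γ S) := by
  rw [SimpleGraph.disjoint_left]
  rintro u v (h | h) (h' | h')
  · exact not_codes_of_marks h' h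
  · exact not_codes_of_marks' h' h
  · exact not_codes_of_marks' h' h
  · exact not_codes_of_marks h' h

section Adj

@[simp] lemma markGraph_ray_ray {i j : ℕ} :
    (markGraph Γ S).Adj (ray i) (ray j) ↔ j = i + 1 ∨ i = j + 1 := Iff.rfl

@[simp] lemma markGraph_leaf_left {i : ℕ} {v : Vtx W} :
    (markGraph Γ S).Adj (leaf i) v ↔ v = ray i := by
  cases v <;> simp [markGraph, Marks]

@[simp] lemma markGraph_leaf_right {i : ℕ} {v : Vtx W} :
    (markGraph Γ S).Adj v (leaf i) ↔ v = ray i := by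
  rw [SimpleGraph.adj_comm, markGraph_leaf_left]

@[simp] lemma markGraph_elt_ray {i j : ℕ} {w : W} :
    (markGraph Γ S).Adj (elt j w) (ray i) ↔ i = 0 ∨ i = j + 1 := by
  simp [markGraph, Marks]

@[simp] lemma markGraph_name_ray {i k : ℕ} {l : List W} :
    (markGraph Γ S).Adj (name l k) (ray i) ↔
      i = k + 1 ∨ i = k + 2 ∨ ∃ j ∈ S, i = k + 3 + j := by
  simp [markGraph, Marks]

lemma markGraph_elt_elt_zero {w w' : W} :
    (markGraph Γ S).Adj (elt 0 w) (elt 0 w') ↔ Γ.Adj w w' := by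
  simp [markGraph, Marks, Γ.adj_comm w' w]

lemma markGraph_elt_elt_succ {i : ℕ} {w w' : W} :
    (markGraph Γ S).Adj (elt 0 w) (elt (i + 1) w') ↔ w = w' := by
  simp [markGraph, Marks]

lemma markGraph_elt_name {j k : ℕ} {w : W} {l : List W} :
    (markGraph Γ S).Adj (elt (k + 1 + j) w) (name l k) ↔ l[j]? = some w := by
  simp [markGraph, Marks]

end Adj

lemma markGraph_adj_map {u v : Vtx W} (σ : Γ ≃g Γ) (h : (markGraph Γ S).Adj u v) :
    (markGraph Γ S).Adj (u.map σ) (v.map σ) := by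
  have (u v : Vtx W) (h : Marks Γ S u v) : Marks Γ S (u.map σ) (v.map σ) := by
    cases u <;> cases v <;> simp_all [Marks, map, σ.map_adj_iff]
  exact h.imp (this u v) (this v u)

/-- The leaves are the vertices of degree one. -/
lemma markGraph_existsUnique_iff {u : Vtx W} :
    (∃ v, ∀ v', (markGraph Γ S).Adj u v' ↔ v' = v) ↔ ∃ i, u = leaf i := by
  constructor
  · rintro ⟨v, hv⟩
    cases u with
    | leaf i => exact ⟨i, rfl⟩
    | ray i =>
      have h₁ := (hv (ray (i + 1))).1 (by simp)
      have h₂ := (hv (leaf i)).1 (by simp)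
      cases h₁.trans h₂.symm
    | elt i w =>
      have h₁ := (hv (ray 0)).1 (by simp)
      have h₂ := (hv (ray (i + 1))).1 (by simp)
      cases h₁.trans h₂.symm
    | name l k =>
      have h₁ := (hv (ray (k + 1))).1 (by simp)
      have h₂ := (hv (ray (k + 2))).1 (by simp)
      cases h₁.trans h₂.symm
  · rintro ⟨i, rfl⟩
    exact ⟨ray i, fun v' => markGraph_leaf_left⟩

end Vtx

/-- A ray has no automorphism besides the identity. -/
lemma eq_id_of_ray_automorphism (τ : ℕ → ℕ) (hτ : Function.Bijective τ)
    (h : ∀ i j, (j = i + 1 ∨ i = j + 1) ↔ (τ j = τ i + 1 ∨ τ i = τ j + 1)) (i : ℕ) : τ i = i := by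
  have h0 : τ 0 = 0 := by
    by_contra h0
    -- Otherwise `τ 0` has two neighbours, but `0` has only one.
    obtain ⟨a, ha⟩ := hτ.2 (τ 0 - 1)
    obtain ⟨b, hb⟩ := hτ.2 (τ 0 + 1)
    have h₁ := (h 0 a).2 (by omega)
    have h₂ := (h 0 b).2 (by omega)
    have : a = b := by omega
    subst this
    omega
  induction i using Nat.strong_induction_on with
  | _ i ih =>
    rcases i with _ | _ | i
    · exact h0
    · have := (h 0 1).1 (by omega)
      change τ 1 = 1
      omega
    · have h₁ := (h (i + 1) (i + 2)).1 (by omega)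
      have h₂ := ih (i + 1) (by omega)
      have h₃ := ih i (by omega)
      have h₄ : τ (i + 2) ≠ τ i := fun h => by
        have := hτ.1 h
        omega
      change τ (i + 2) = i + 2
      omega

namespace Vtx

variable {W : Type*} {Γ : SimpleGraph W} {S S' : Set ℕ}

section Rigid

variable (φ : markGraph Γ S ≃g markGraph Γ S')

lemma exists_leaf_map_leaf (i : ℕ) : ∃ j, φ (leaf i) = leaf j := by
  rw [← markGraph_existsUnique_iff (Γ := Γ) (S := S')]
  obtain ⟨v, hv⟩ := markGraph_existsUnique_iff (Γ := Γ) (S := S).2 ⟨i, rfl⟩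
  refine ⟨φ v, fun v' => ?_⟩
  obtain ⟨v', rfl⟩ := φ.surjective v'
  rw [φ.map_adj_iff, hv, φ.injective.eq_iff]

lemma map_ray (i : ℕ) : φ (ray i) = ray i := by
  choose τ hτ using exists_leaf_map_leaf φ
  choose τ' hτ' using exists_leaf_map_leaf φ.symm
  have hray (i) : φ (ray i) = ray (τ i) := by
    have : (markGraph Γ S').Adj (φ (leaf i)) (φ (ray i)) := φ.map_adj_iff.2 (by simp)
    rwa [hτ, markGraph_leaf_left] at this
  rw [hray]
  congr 1
  refine eq_id_of_ray_automorphism τ ⟨fun i j h => ?_, fun j => ⟨τ' j, ?_⟩⟩ (fun i j => ?_) i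
  · have : φ (leaf i) = φ (leaf j) := by rw [hτ, hτ, h]
    simpa using φ.injective this
  · have : φ (φ.symm (leaf j)) = leaf j := φ.apply_symm_apply _
    rw [hτ', hτ] at this
    simpa using this
  · rw [← markGraph_ray_ray (Γ := Γ) (S := S), ← markGraph_ray_ray (Γ := Γ) (S := S'),
      ← φ.map_adj_iff, hray, hray]

lemma map_leaf (i : ℕ) : φ (leaf i) = leaf i := by
  obtain ⟨j, hj⟩ := exists_leaf_map_leaf φ i
  have : (markGraph Γ S').Adj (φ (leaf i)) (φ (ray i)) := φ.map_adj_iff.2 (by simp)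
  rw [hj, map_ray, markGraph_leaf_left] at this
  rw [hj]
  simpa using this.symm

lemma adj_map_ray {v : Vtx W} {i : ℕ} :
    (markGraph Γ S').Adj (φ v) (ray i) ↔ (markGraph Γ S).Adj v (ray i) := by
  rw [← φ.map_adj_iff, map_ray]

lemma exists_map_elt (i : ℕ) (w : W) : ∃ w', φ (elt i w) = elt i w' := by
  have h (j : ℕ) := adj_map_ray φ (v := elt i w) (i := j)
  cases hv : φ (elt i w) with
  | ray j =>
    rw [← map_ray φ] at hv
    cases φ.injective hv
  | leaf j =>
    rw [← map_leaf φ] at hv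
    cases φ.injective hv
  | elt j w' =>
    have := h (i + 1)
    rw [hv] at this
    simp at this
    subst this
    exact ⟨w', rfl⟩
  | name l k =>
    have := h 0
    rw [hv] at this
    simp at this
    omega

lemma exists_map_name (l : List W) (k : ℕ) : ∃ l', φ (name l k) = name l' k ∧ S = S' := by
  have h (j : ℕ) := adj_map_ray φ (v := name l k) (i := j)
  cases hv : φ (name l k) with
  | ray j =>
    rw [← map_ray φ] at hv
    cases φ.injective hv
  | leaf j =>
    rw [← map_leaf φ] at hv
    cases φ.injective hv
  | elt j w' =>
    have := h 0
    rw [hv] at this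
    simp at this
    omega
  | name l' k' =>
    rw [hv] at h
    simp only [markGraph_name_ray] at h
    have h₁ := (h (k + 1)).2 (by omega)
    have h₂ := (h (k' + 1)).1 (by omega)
    obtain rfl : k = k' := by
      rcases h₁ with h₁ | h₁ | ⟨j₁, -, h₁⟩ <;> rcases h₂ with h₂ | h₂ | ⟨j₂, -, h₂⟩ <;> omega
    refine ⟨l', rfl, Set.ext fun j => ?_⟩
    have hmem (T : Set ℕ) : (k + 3 + j = k + 1 ∨ k + 3 + j = k + 2 ∨
        ∃ i ∈ T, k + 3 + j = k + 3 + i) ↔ j ∈ T := by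
      refine ⟨?_, fun h => Or.inr (Or.inr ⟨j, h, rfl⟩)⟩
      rintro (h | h | ⟨i, hi, h⟩)
      · omega
      · omega
      · obtain rfl : j = i := by omega
        exact hi
    rw [← hmem S, ← hmem S']
    exact (h (k + 3 + j)).symm

/-- The additional edges determine the set `S`, and every automorphism comes from `Γ`. -/
theorem markGraph_rigid : S = S' ∧ ∃ σ : Γ ≃g Γ, ∀ v, φ v = v.map σ := by
  obtain ⟨-, -, hS⟩ := exists_map_name φ [] 0
  refine ⟨hS, ?_⟩
  choose σ hσ using exists_map_elt φ
  choose τ hτ using exists_map_elt φ.symm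
  have hσ_succ (i w) : σ (i + 1) w = σ 0 w := by
    have : (markGraph Γ S').Adj (φ (elt 0 w)) (φ (elt (i + 1) w)) :=
      φ.map_adj_iff.2 (markGraph_elt_elt_succ.2 rfl)
    rw [hσ, hσ] at this
    exact (markGraph_elt_elt_succ.1 this).symm
  have hσ' (i w) : φ (elt i w) = elt i (σ 0 w) := by
    cases i with
    | zero => exact hσ 0 w
    | succ i => rw [hσ, hσ_succ]
  let e : Γ ≃g Γ :=
    { toFun := σ 0
      invFun := τ 0
      left_inv := fun w => by
        have := φ.symm_apply_apply (elt 0 w)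
        rw [hσ, hτ] at this
        simpa using this
      right_inv := fun w => by
        have := φ.apply_symm_apply (elt 0 w)
        rw [hτ, hσ] at this
        simpa using this
      map_rel_iff' := fun {w w'} => by
        change Γ.Adj (σ 0 w) (σ 0 w') ↔ _
        rw [← markGraph_elt_elt_zero (S := S'), ← hσ, ← hσ, φ.map_adj_iff,
          markGraph_elt_elt_zero] }
  refine ⟨e, fun v => ?_⟩
  cases v with
  | ray i => exact map_ray φ i
  | leaf i => exact map_leaf φ i
  | elt i w => exact hσ' i w
  | name l k =>
    obtain ⟨l', hl', -⟩ := exists_map_name φ l k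
    rw [hl']
    change name l' k = name (l.map e) k
    congr 1
    refine List.ext_getElem? fun j => Option.ext fun w => ?_
    obtain ⟨w, rfl⟩ := e.surjective w
    rw [List.getElem?_map, ← markGraph_elt_name (Γ := Γ) (S := S') (k := k), ← hl']
    change (markGraph Γ S').Adj (elt _ (σ 0 w)) _ ↔ _
    rw [← hσ', φ.map_adj_iff, markGraph_elt_name]
    simp [Option.map_eq_some_iff]

end Rigid

end Vtx

/-! ### Injective endomorphisms given by a graph with additional edges -/

namespace GraphEnd

open MulOpposite

section
variable {V U : Type*} {R : SimpleGraph V} {Q X X' : SimpleGraph U}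

lemma unop_apply_of_eq_mul {f g h : GraphEnd R} (H : f = g * h) (x : V) :
    f.unop x = h.unop (g.unop x) := by
  subst H
  rfl

lemma unop_apply_of_mul_eq {f g h : GraphEnd R} (H : g * h = f) (x : V) :
    h.unop (g.unop x) = f.unop x :=
  (unop_apply_of_eq_mul H.symm x).symm

lemma exists_iso_of_injective {a b : GraphEnd R} (hab : ∀ x, a.unop (b.unop x) = x)
    (ha : Function.Injective a.unop) : ∃ e : R ≃g R, ∀ x, e x = a.unop x := by
  have hba (x : V) : b.unop (a.unop x) = x := ha (hab _)
  refine ⟨{ toFun := a.unop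
            invFun := b.unop
            left_inv := hba
            right_inv := hab
            map_rel_iff' := fun {x y} => ⟨fun h => ?_, fun h => a.unop.map_adj h⟩ }, fun x => rfl⟩
  have := b.unop.map_adj h
  change R.Adj (b.unop (a.unop x)) (b.unop (a.unop y)) at this
  rwa [hba, hba] at this

/-- The endomorphism `R ≅ Q ≤ X ↪ R` given by a copy `Q` of `R`, a graph `X` that has the edges of
`Q` and additional edges, and an embedding of `X` in `R`. -/
def ofSpanning (hQX : Q ≤ X) (j : R ≃g Q) (i : X ↪g R) : GraphEnd R :=
  op (i.toHom.comp ((SimpleGraph.Hom.ofLE hQX).comp j.toHom))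

variable {hQX : Q ≤ X} {hQX' : Q ≤ X'} {j : R ≃g Q} {i : X ↪g R} {i' : X' ↪g R}

lemma unop_ofSpanning_apply (x : V) : (ofSpanning hQX j i).unop x = i (j x) := rfl

lemma unop_ofSpanning_injective : Function.Injective (ofSpanning hQX j i).unop :=
  i.injective.comp j.injective

/-- An injective endomorphism that is regular has a left inverse, so it reflects adjacency. -/
lemma le_of_isRegularElem (h : Green.IsRegularElem (ofSpanning hQX j i)) : X ≤ Q := by
  obtain ⟨g, hg⟩ := h
  have hgf (x : V) : g.unop (i (j x)) = x :=
    unop_ofSpanning_injective (unop_apply_of_mul_eq hg x)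
  intro u v huv
  have := g.unop.map_adj (i.map_adj_iff.2 huv)
  obtain ⟨x, rfl⟩ := j.surjective u
  obtain ⟨y, rfl⟩ := j.surjective v
  rw [j.map_adj_iff]
  change R.Adj (g.unop (i (j x))) (g.unop (i (j y))) at this
  rwa [hgf, hgf] at this

/-- If, up to an automorphism `e` of `R`, the endomorphisms `n` and `n'` carry the images of two
endomorphisms `R ≅ Q ≤ X ↪ R` and `R ≅ Q ≤ X' ↪ R` to each other, then the pairs `Q ≤ X` and
`Q ≤ X'` are isomorphic. -/
lemma exists_iso_of_mul (e : R ≃g R) {n n' : GraphEnd R}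
    (h : ∀ x, n.unop (i (j x)) = i' (j (e x))) (h' : ∀ x, n'.unop (i' (j (e x))) = i (j x)) :
    ∃ φ : Q ≃g Q, (∀ u v, X'.Adj (φ u) (φ v) ↔ X.Adj u v) ∧ ∀ u, n.unop (i u) = i' (φ u) := by
  let φ : Q ≃g Q := (j.symm.trans e).trans j
  have h₁ (u : U) : n.unop (i u) = i' (φ u) := by
    simpa [φ] using h (j.symm u)
  have h₂ (u : U) : n'.unop (i' (φ u)) = i u := by
    simpa [φ] using h' (j.symm u)
  refine ⟨φ, fun u v => ⟨fun huv => ?_, fun huv => ?_⟩, h₁⟩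
  · have := n'.unop.map_adj (i'.map_adj_iff.2 huv)
    change R.Adj (n'.unop (i' (φ u))) (n'.unop (i' (φ v))) at this
    rwa [h₂, h₂, i.map_adj_iff] at this
  · have := n.unop.map_adj (i.map_adj_iff.2 huv)
    change R.Adj (n.unop (i u)) (n.unop (i v)) at this
    rwa [h₁, h₁, i'.map_adj_iff] at this

/-- The `D`-class of `R ≅ Q ≤ X ↪ R` determines the pair `Q ≤ X` up to isomorphism. -/
lemma exists_iso_of_relD
    (h : Green.RelD (ofSpanning hQX j i) (ofSpanning hQX' j i')) :
    ∃ φ : Q ≃g Q, ∀ u v, X'.Adj (φ u) (φ v) ↔ X.Adj u v := by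
  obtain ⟨k, hL, hR⟩ := h
  obtain ⟨⟨m', hm'⟩, m, hm⟩ := Green.relL_iff.1 hL
  obtain ⟨⟨n', hn'⟩, n, hn⟩ := Green.relR_iff.1 hR
  have hmm (x : V) : m.unop (m'.unop x) = x := by
    apply unop_ofSpanning_injective (hQX := hQX) (j := j) (i := i)
    rw [← unop_apply_of_eq_mul hm, ← unop_apply_of_eq_mul hm']
  have hm_inj : Function.Injective m.unop := fun x y hxy => by
    apply unop_ofSpanning_injective (hQX := hQX') (j := j) (i := i')
    rw [unop_apply_of_eq_mul hn, unop_apply_of_eq_mul hm, hxy, ← unop_apply_of_eq_mul hm,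
      ← unop_apply_of_eq_mul hn]
  obtain ⟨e, he⟩ := exists_iso_of_injective hmm hm_inj
  have key (x : V) : k.unop (e.symm x) = i (j x) := by
    rw [unop_apply_of_eq_mul hm, ← he, e.apply_symm_apply]
    rfl
  obtain ⟨φ, hφ, -⟩ := exists_iso_of_mul (i := i) (i' := i') (j := j) e.symm (n := n) (n' := n')
    (fun x => by rw [← key, ← unop_apply_of_eq_mul hn]; rfl)
    (fun x => by rw [← key, unop_apply_of_eq_mul hn']; rfl)
  exact ⟨φ, hφ⟩

/-- Right multiplication by an element that keeps `R ≅ Q ≤ X ↪ R` in its `H`-class acts on the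
image as a common automorphism of `Q` and `X`. -/
lemma exists_iso_of_relH {t : GraphEnd R}
    (h : Green.RelH (ofSpanning hQX j i) (ofSpanning hQX j i * t)) :
    ∃ φ : Q ≃g Q, (∀ u v, X.Adj (φ u) (φ v) ↔ X.Adj u v) ∧ ∀ u, t.unop (i u) = i (φ u) := by
  obtain ⟨hL, hR⟩ := h
  obtain ⟨⟨m', hm'⟩, m, hm⟩ := Green.relL_iff.1 hL
  obtain ⟨⟨t', ht'⟩, -⟩ := Green.relR_iff.1 hR
  have hft (x : V) : t.unop (i (j x)) = i (j (m.unop x)) := unop_apply_of_eq_mul hm x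
  have hft' (x : V) : t'.unop (t.unop (i (j x))) = i (j x) := (unop_apply_of_eq_mul ht' x).symm
  have hmm (x : V) : m.unop (m'.unop x) = x := by
    apply unop_ofSpanning_injective (hQX := hQX) (j := j) (i := i)
    rw [unop_ofSpanning_apply, ← hft]
    exact (unop_apply_of_eq_mul hm' x).symm
  have hm_inj : Function.Injective m.unop := fun x y hxy => by
    apply unop_ofSpanning_injective (hQX := hQX) (j := j) (i := i)
    rw [unop_ofSpanning_apply, unop_ofSpanning_apply, ← hft', hft, hxy, ← hft, hft']
  obtain ⟨e, he⟩ := exists_iso_of_injective hmm hm_inj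
  exact exists_iso_of_mul e (n' := t') (fun x => by rw [he, hft])
    (fun x => by rw [he, ← hft, hft'])

/-- If `X` is a retract of `R`, the Schützenberger group of `R ≅ Q ≤ X ↪ R` is the group of common
automorphisms of `Q` and `X`. -/
theorem nonempty_schutzenbergerGroup_ofSpanning_equiv {r : R →g X} (hr : ∀ u, r (i u) = u)
    {G : Type*} [Group G] (A : G →* Equiv.Perm U) (hA : Function.Injective A)
    (hAQX : ∀ φ : Equiv.Perm U, φ ∈ A.range ↔
      (∀ u v, Q.Adj (φ u) (φ v) ↔ Q.Adj u v) ∧ ∀ u v, X.Adj (φ u) (φ v) ↔ X.Adj u v) :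
    Nonempty (Green.schutzenbergerGroup (Green.classH (ofSpanning hQX j i)) ≃* G) := by
  let f := ofSpanning hQX j i
  have hAQ (σ : G) := ((hAQX (A σ)).1 ⟨σ, rfl⟩).1
  have hAX (σ : G) := ((hAQX (A σ)).1 ⟨σ, rfl⟩).2
  -- The endomorphism of `R` that extends the automorphism `A σ` of `X`.
  let t (σ : G) : GraphEnd R := op
    { toFun := fun x => i (A σ (r x))
      map_rel' := fun h => i.map_adj_iff.2 ((hAX σ _ _).2 (r.map_adj h)) }
  -- The automorphism of `R` that corresponds to the automorphism `A σ` of `Q`.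
  let m (σ : G) : GraphEnd R := op
    { toFun := fun x => j.symm (A σ (j x))
      map_rel' := fun h => j.symm.map_adj_iff.2 ((hAQ σ _ _).2 (j.map_adj_iff.2 h)) }
  have hft (σ : G) : f * t σ = m σ * f := by
    apply unop_injective
    ext x
    change i (A σ (r (i (j x)))) = i (j (j.symm (A σ (j x))))
    rw [hr, j.apply_symm_apply]
  have ht_mul (σ τ : G) : f * t (σ * τ) = f * (t τ * t σ) := by
    apply unop_injective
    ext x
    change i (A (σ * τ) (r (i (j x)))) = i (A σ (r (i (A τ (r (i (j x)))))))
    rw [hr, hr, map_mul, Equiv.Perm.mul_apply]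
  have hm_mul (σ τ : G) : m σ * m τ = m (τ * σ) := by
    apply unop_injective
    ext x
    change j.symm (A τ (j (j.symm (A σ (j x))))) = j.symm (A (τ * σ) (j x))
    rw [j.apply_symm_apply, map_mul, Equiv.Perm.mul_apply]
  have ht_one : f * t 1 = f * 1 := by
    apply unop_injective
    ext x
    change i (A 1 (r (i (j x)))) = i (j x)
    rw [hr, map_one, Equiv.Perm.one_apply]
  have ht_mem (σ : G) : t σ ∈ Green.stabT (Green.classH f) := by
    rw [Green.mem_stabT_classH]
    refine ⟨Green.relL_iff.2 ⟨⟨m σ⁻¹, ?_⟩, m σ, hft σ⟩, Green.relR_iff.2 ⟨⟨t σ⁻¹, ?_⟩, t σ, rfl⟩⟩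
    · rw [hft, ← mul_assoc, hm_mul, mul_inv_cancel, ← hft, ht_one, mul_one]
    · rw [mul_assoc, ← ht_mul, inv_mul_cancel, ht_one, mul_one]
  let Φ : G →* Green.schutzenbergerGroup (Green.classH f) :=
    { toFun := fun σ => ⟨_, ⟨t σ⁻¹, ht_mem σ⁻¹⟩, rfl⟩
      map_one' := by
        apply Subtype.ext
        refine (Green.gammaHom_eq_iff.2 ?_).trans (map_one (Green.gammaHom _))
        rw [inv_one]
        exact ht_one
      -- The maps `γ_t` are composed from left to right, so inverses turn `t` into a homomorphism.
      map_mul' := fun σ τ => by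
        apply Subtype.ext
        refine (Green.gammaHom_eq_iff.2 ?_).trans (map_mul (Green.gammaHom _) _ _)
        rw [mul_inv_rev]
        exact ht_mul _ _ }
  have hΦ : Function.Bijective Φ := by
    constructor
    · intro σ τ h
      have h' := Green.gammaHom_eq_iff.1 (congrArg Subtype.val h)
      apply inv_injective
      apply hA
      ext u
      have := congrArg (fun g : GraphEnd R => g.unop (j.symm u)) h'
      change i (A σ⁻¹ (r (i (j (j.symm u))))) = i (A τ⁻¹ (r (i (j (j.symm u))))) at this
      rwa [hr, j.apply_symm_apply, i.injective.eq_iff] at this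
    · rintro ⟨_, ⟨s, hs⟩, rfl⟩
      obtain ⟨φ, hφX, hφ⟩ := exists_iso_of_relH (Green.mem_stabT_classH.1 hs)
      obtain ⟨σ, hσ⟩ := (hAQX φ.toEquiv).2 ⟨fun u v => φ.map_adj_iff, hφX⟩
      refine ⟨σ⁻¹, Subtype.ext (Green.gammaHom_eq_iff.2 ?_)⟩
      apply unop_injective
      ext x
      change i (A σ⁻¹⁻¹ (r (i (j x)))) = s.unop (i (j x))
      rw [inv_inv, hr, hφ, hσ]
      rfl
  exact ⟨(MulEquiv.ofBijective Φ hΦ).symm⟩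

end

end GraphEnd

/-! ### Counting the `D`-classes -/

namespace Vtx

variable {W : Type*} (Γ : SimpleGraph W) (S : Set ℕ)

/-- The action of the automorphism group of `Γ` on the vertices. -/
def autHom : (Γ ≃g Γ) →* Equiv.Perm (Vtx W) where
  toFun σ :=
    { toFun := map σ
      invFun := map σ.symm
      left_inv := fun v => by
        rw [map_map]
        convert map_id v
        funext w
        exact σ.symm_apply_apply w
      right_inv := fun v => by
        rw [map_map]
        convert map_id v
        funext w
        exact σ.apply_symm_apply w }
  map_one' := Equiv.ext map_id
  map_mul' σ τ := Equiv.ext fun v => (map_map τ σ v).symm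

lemma autHom_injective : Function.Injective (autHom Γ) := by
  intro σ τ h
  ext w
  have : elt 0 (σ w) = elt 0 (τ w) := DFunLike.congr_fun h (elt 0 w)
  simpa using this

variable {Γ S}

lemma markGraph_adj_iff {u v : Vtx W} : (markGraph Γ S).Adj u v ↔
    (codeGraph W ⊔ markGraph Γ S).Adj u v ∧ ¬ (codeGraph W).Adj u v :=
  ⟨fun h => ⟨Or.inr h, fun h' => SimpleGraph.disjoint_left.1 disjoint_codeGraph_markGraph _ _ h' h⟩,
    fun h => h.1.resolve_left h.2⟩

/-- A permutation that respects both graphs with their additional edges respects the additional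
edges. -/
lemma exists_markGraph_iso {S' : Set ℕ} (φ : Equiv.Perm (Vtx W))
    (h : ∀ u v, (codeGraph W).Adj (φ u) (φ v) ↔ (codeGraph W).Adj u v)
    (h' : ∀ u v, (codeGraph W ⊔ markGraph Γ S').Adj (φ u) (φ v) ↔
      (codeGraph W ⊔ markGraph Γ S).Adj u v) :
    ∃ ψ : markGraph Γ S ≃g markGraph Γ S', ∀ v, ψ v = φ v :=
  ⟨{ toEquiv := φ
     map_rel_iff' := by
      intro u v
      rw [markGraph_adj_iff, markGraph_adj_iff, h, h'] }, fun _ => rfl⟩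

lemma mem_range_autHom_iff (S : Set ℕ) (φ : Equiv.Perm (Vtx W)) : φ ∈ (autHom Γ).range ↔
    (∀ u v, (codeGraph W).Adj (φ u) (φ v) ↔ (codeGraph W).Adj u v) ∧
    ∀ u v, (codeGraph W ⊔ markGraph Γ S).Adj (φ u) (φ v) ↔
      (codeGraph W ⊔ markGraph Γ S).Adj u v := by
  constructor
  · rintro ⟨σ, rfl⟩
    have hinv (u : Vtx W) : (u.map σ).map σ.symm = u := (autHom Γ σ).symm_apply_apply u
    have h₁ (u v : Vtx W) : (codeGraph W).Adj (u.map σ) (v.map σ) ↔ (codeGraph W).Adj u v :=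
      ⟨fun h => by simpa only [hinv] using codeGraph_adj_map σ.symm h, codeGraph_adj_map σ⟩
    have h₂ (u v : Vtx W) : (markGraph Γ S).Adj (u.map σ) (v.map σ) ↔ (markGraph Γ S).Adj u v :=
      ⟨fun h => by simpa only [hinv] using markGraph_adj_map σ.symm h, markGraph_adj_map σ⟩
    exact ⟨h₁, fun u v => or_congr (h₁ u v) (h₂ u v)⟩
  · rintro ⟨h, h'⟩
    obtain ⟨ψ, hψ⟩ := exists_markGraph_iso φ h h'
    obtain ⟨-, σ, hσ⟩ := markGraph_rigid ψ
    exact ⟨σ, Equiv.ext fun v => (hσ v).symm.trans (hψ v)⟩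

end Vtx

lemma GraphEnd.mk_le {V : Type*} [Countable V] (R : SimpleGraph V) :
    Cardinal.mk (GraphEnd R) ≤ 2 ^ Cardinal.aleph0 := by
  have h : Function.Injective (fun f : GraphEnd R => (f.unop : V → V)) := fun f g h =>
    MulOpposite.unop_injective (DFunLike.coe_injective h)
  refine (Cardinal.mk_le_of_injective h).trans ?_
  rw [← Cardinal.power_def]
  calc Cardinal.mk V ^ Cardinal.mk V ≤ Cardinal.aleph0 ^ Cardinal.mk V :=
        Cardinal.power_le_power_right Cardinal.mk_le_aleph0
    _ ≤ Cardinal.aleph0 ^ Cardinal.aleph0 :=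
        Cardinal.power_le_power_left Cardinal.aleph0_ne_zero Cardinal.mk_le_aleph0
    _ = 2 ^ Cardinal.aleph0 := by
        rw [Cardinal.aleph0_power_aleph0, Cardinal.two_power_aleph0]

theorem mainTheorem2 {V : Type*} (R : SimpleGraph V) (hR : IsCountableUniversalGraph R)
    {W : Type*} [Countable W] (Γ : SimpleGraph W) :
    Cardinal.mk {D : Set (GraphEnd R) // Green.IsNonregularClassD D ∧
      ∀ h ∈ D, Nonempty (Green.schutzenbergerGroup (Green.classH h) ≃* (Γ ≃g Γ))} =
    2 ^ Cardinal.aleph0 := by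
  have := hR.countable
  apply le_antisymm
  · refine le_trans ?_ (GraphEnd.mk_le R)
    let rep (D : {D : Set (GraphEnd R) // Green.IsNonregularClassD D ∧
      ∀ h ∈ D, Nonempty (Green.schutzenbergerGroup (Green.classH h) ≃* (Γ ≃g Γ))}) : GraphEnd R :=
      D.2.1.1.choose
    have hrep (D) : D.1 = Green.classD (rep D) := D.2.1.1.choose_spec
    refine Cardinal.mk_le_of_injective (f := rep) fun D D' h => Subtype.ext ?_
    rw [hrep, hrep, h]
  · have hQ := Vtx.codeGraph_hasExtensionProperty W
    obtain ⟨j⟩ := hR.hasExtensionProperty.nonempty_iso hQ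
    have hX (S : Set ℕ) : ∀ A : Finset (Vtx W), ∃ z, ∀ a ∈ A,
        (Vtx.codeGraph W ⊔ Vtx.markGraph Γ S).Adj z a := fun A => by
      obtain ⟨z, -, hz, -⟩ := hQ A ∅ (Finset.disjoint_empty_right A)
      exact ⟨z, fun a ha => Or.inl (hz a ha)⟩
    choose i r hr using fun S => hR.hasExtensionProperty.exists_retract (hX S)
    let f (S : Set ℕ) : GraphEnd R := GraphEnd.ofSpanning le_sup_left j (i S)
    have hreg (S : Set ℕ) : ¬ Green.IsRegularElem (f S) := fun h => by
      have hle := GraphEnd.le_of_isRegularElem h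
      have hadj : (Vtx.markGraph Γ S).Adj (Vtx.ray 0) (Vtx.ray 1) := by simp
      exact (Vtx.markGraph_adj_iff.1 hadj).2 (hle (Or.inr hadj))
    have hS (S : Set ℕ) := GraphEnd.nonempty_schutzenbergerGroup_ofSpanning_equiv
      (hQX := le_sup_left) (j := j) (hr S) (Vtx.autHom Γ) (Vtx.autHom_injective Γ)
      (Vtx.mem_range_autHom_iff S)
    let F (S : ULift (Set ℕ)) : {D : Set (GraphEnd R) // Green.IsNonregularClassD D ∧
        ∀ h ∈ D, Nonempty (Green.schutzenbergerGroup (Green.classH h) ≃* (Γ ≃g Γ))} :=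
      ⟨Green.classD (f S.down), ⟨⟨_, rfl⟩, fun g hg h => hreg _ (h.of_relD hg)⟩, fun g hg => by
        obtain ⟨e₁⟩ := Green.schutzenbergerGroup_congr_of_relD hg
        obtain ⟨e₂⟩ := hS S.down
        exact ⟨e₁.symm.trans e₂⟩⟩
    have hF : Function.Injective F := by
      rintro ⟨S⟩ ⟨S'⟩ h
      have hmem : f S' ∈ Green.classD (f S) := by
        rw [show Green.classD (f S) = Green.classD (f S') from congrArg Subtype.val h]
        exact Green.relD_refl _
      obtain ⟨φ, hφ⟩ := GraphEnd.exists_iso_of_relD hmem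
      obtain ⟨ψ, -⟩ := Vtx.exists_markGraph_iso φ.toEquiv (fun _ _ => φ.map_adj_iff) hφ
      exact congrArg _ (Vtx.markGraph_rigid ψ).1
    calc 2 ^ Cardinal.aleph0 = Cardinal.mk (ULift (Set ℕ)) := by simp
      _ ≤ _ := Cardinal.mk_le_of_injective hF
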